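/- For nonnegative integers $n$ let $H_n=\sum_{k=1}^n \frac1k$ (so $H_0=0$), for $x\in\mathbb{Q}$ and $k\ge 0$ let $(x)_k=x(x+1)\cdots(x+k-1)$ (so $(x)_0=1$), and for a nonzero integer $u$ let \[T_n^{(u)}=\sum_{k=0}^n\binom{n}{k}^{u}\bigl\{1+u(n-2k)H_k\bigr\}.\] Then for every integer $m\ge 1$ and every integer $n\ge 0$, \[T_n^{(1-2m)}=(1+n)^m\sum_{0\le i_1\le i_2\le\cdots\le i_m\le n}\frac{1}{1+n-i_1}\prod_{r=1}^{m-1}\frac{(1)_{i_r}\,(-i_{r+1})_{i_r}}{(-n)_{i_r}\,(1+n-i_{r+1})_{i_r+1}},\] where the empty product (for $m=1$) is $1$. In particular, for every integer $n\ge 0$, \[T_n^{(-3)}=(1+n)^2\sum_{i=0}^n\sum_{j=0}^i\frac{(1)_j(-i)_j}{(-n)_j(1+n-i)_{j+1}}\,\frac{1}{1+n-j},\] \[T_n^{(-5)}=(1+n)^3\sum_{i=0}^n\sum_{j=0}^i\frac{(1)_j(-i)_j}{(-n)_j(1+n-i)_{j+1}}\sum_{t=0}^j\frac{(1)_t(-j)_t}{(-n)_t(1+n-j)_{t+1}}\,\frac{1}{1+n-t}.\]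 -/

import Mathlib

/-- The shifted factorial `(x)_k = x (x + 1) ⋯ (x + k - 1)`, with `(x)_0 = 1`. -/
noncomputable def shiftedFactorial (x : ℚ) (k : ℕ) : ℚ :=
  (ascPochhammer ℚ k).eval x

/-- `T_n^{(u)} = ∑_{k=0}^n binom(n,k)^u {1 + u (n - 2k) H_k}`, where `H_k` is the harmonic number.
The power is an integer power; the subtraction takes place in `ℚ`. -/
def pauleSchneiderT (n : ℕ) (u : ℤ) : ℚ :=
  ∑ k ∈ Finset.range (n + 1),
    ((n.choose k : ℚ)) ^ u * (1 + (u : ℚ) * ((n : ℚ) - 2 * (k : ℚ)) * harmonic k)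

/-- The factor `(1)_j (-i)_j / ((-n)_j (1 + n - i)_{j+1})`; it is used for `0 ≤ j ≤ i ≤ n` only,
where the denominator does not vanish. -/
noncomputable def linkFactor (n j i : ℕ) : ℚ :=
  shiftedFactorial 1 j * shiftedFactorial (-(i : ℚ)) j /
    (shiftedFactorial (-(n : ℚ)) j * shiftedFactorial (1 + (n : ℚ) - (i : ℚ)) (j + 1))

/-!
The sum `T_n^{(1-2m)}` is a derivative. Put `a = x - n` and

`Φ(x) = ∑_{k ≤ n} (-1)^k (x - n + 2k) (-n)_k / (1 + x)_k · (k! / (x - n)_k)^{2m}`.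

At `x = 0` the terms are `-binom(n,k)^{1-2m} (n - 2k)`, which cancel in pairs under `k ↦ n - k`.
Logarithmic differentiation of the terms produces harmonic numbers, and the same symmetry turns
`Φ'(0)` into `T_n^{(1-2m)}` (`hasDerivAt_deformedSum`).

On the other hand `Φ(x)` is a very well poised sum, and for generic `x` a Bailey chain evaluates it.
Let `K` be the lower triangular kernel `baileyKernel a`, whose value at `x = 0` is
`(n + 1) * linkFactor n`. The columns of `baileyMatrix a` are eigenvectors of `K` with eigenvalues
`(k! / (a)_k)^2`; this is the Pfaff–Saalschütz sum (`saalschuetz_sum`,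
`sum_baileyKernel_mul_baileyMatrix`). The sequence `e = (1, 0, 0, …)` is an explicit combination of
these columns, the unit Bailey pair (`sum_unitBaileyCoeff_mul_baileyMatrix`), so `K^m e` is known.
Summing its entries against the weights `(-n)_i / (a)_i`, which are `1` at `x = 0`, with the help of
the Chu–Vandermonde sum (`sum_baileyMatrix`) gives `x · R(x) = Φ(x)`, where
`R(x) = ∑_{i ≤ n} (-n)_i / (a)_i · (K^m e)(i)` (`mul_sum_iterate_baileyKernel`).

The eigenvalues for `k` and `n - k` collide at `x = 0`, so the decomposition itself degenerates
there; but `R` is continuous at `0`, whence `T_n^{(1-2m)} = Φ'(0) = R(0)`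
(`pauleSchneiderT_eq_sum_iterate`). One application of the kernel turns `e` into
`i ↦ 1 / (1 + n - i)`, and the other `m - 1` applications unroll into the sum over tuples
`i_1 ≤ ⋯ ≤ i_m`; the monotonicity constraint costs nothing, as `linkFactor n j i = 0` for `i < j`.
-/

/-! ### Shifted factorials -/

theorem shiftedFactorial_zero (x : ℚ) : shiftedFactorial x 0 = 1 := by
  simp [shiftedFactorial]

theorem shiftedFactorial_succ (x : ℚ) (k : ℕ) :
    shiftedFactorial x (k + 1) = shiftedFactorial x k * (x + k) := by
  simp [shiftedFactorial, ascPochhammer_succ_eval]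

theorem shiftedFactorial_add (x : ℚ) (k l : ℕ) :
    shiftedFactorial x (k + l) = shiftedFactorial x k * shiftedFactorial (x + k) l := by
  induction l with
  | zero => simp [shiftedFactorial_zero]
  | succ l ih =>
    rw [← add_assoc, shiftedFactorial_succ, ih, shiftedFactorial_succ]
    push_cast
    ring

theorem shiftedFactorial_succ_left (x : ℚ) (k : ℕ) :
    shiftedFactorial x (k + 1) = x * shiftedFactorial (x + 1) k := by
  rw [add_comm, shiftedFactorial_add, shiftedFactorial_succ, shiftedFactorial_zero]
  simp

theorem shiftedFactorial_ne_zero {x : ℚ} {k : ℕ} (h : ∀ j < k, x + (j : ℚ) ≠ 0) :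
    shiftedFactorial x k ≠ 0 := by
  induction k with
  | zero => simp [shiftedFactorial_zero]
  | succ k ih =>
    rw [shiftedFactorial_succ]
    exact mul_ne_zero (ih fun j hj => h j (by omega)) (h k (by omega))

theorem factorial_add_eq_mul_shiftedFactorial (k s : ℕ) :
    ((k + s).factorial : ℚ) = k.factorial * shiftedFactorial (k + 1) s := by
  induction s with
  | zero => simp [shiftedFactorial_zero]
  | succ s ih =>
    rw [← add_assoc, Nat.factorial_succ, shiftedFactorial_succ]
    push_cast
    rw [ih]
    ring

theorem shiftedFactorial_one (k : ℕ) : shiftedFactorial 1 k = k.factorial := by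
  have := factorial_add_eq_mul_shiftedFactorial 0 k
  simpa using this.symm

/-- In the form `(-(j + r))_j = (-1)^j (j + r)! / r!`, cleared of the denominator. -/
theorem shiftedFactorial_neg_mul_factorial (j r : ℕ) :
    shiftedFactorial (-((j : ℚ) + r)) j * r.factorial = (-1) ^ j * (j + r).factorial := by
  induction j with
  | zero => simp [shiftedFactorial_zero]
  | succ j ih =>
    rw [shiftedFactorial_succ_left,
      show -(((j + 1 : ℕ) : ℚ) + r) + 1 = -((j : ℚ) + r) by push_cast; ring, mul_assoc, ih,
      show j + 1 + r = (j + r) + 1 by ring, Nat.factorial_succ]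
    push_cast
    ring

theorem shiftedFactorial_neg_natCast_eq_zero {i j : ℕ} (h : i < j) :
    shiftedFactorial (-(i : ℚ)) j = 0 := by
  obtain ⟨l, rfl⟩ : ∃ l, j = i + 1 + l := ⟨j - (i + 1), by omega⟩
  rw [shiftedFactorial_add, shiftedFactorial_succ]
  simp

/-! ### The Vandermonde and Saalschütz sums -/

/-- The Chu–Vandermonde sum, cleared of denominators. -/
theorem sum_choose_mul_shiftedFactorial (p : ℕ) (A C : ℚ) :
    ∑ s ∈ Finset.range (p + 1), (p.choose s : ℚ) *
      ((-1) ^ s * shiftedFactorial A s * shiftedFactorial (C + s) (p - s)) =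
      shiftedFactorial (C - A) p := by
  induction p generalizing C with
  | zero => simp [shiftedFactorial_zero]
  | succ p ih =>
    rw [Finset.sum_choose_succ_mul
      (fun s t => (-1) ^ s * shiftedFactorial A s * shiftedFactorial (C + s) t),
      ← Finset.sum_add_distrib, shiftedFactorial_succ_left,
      show C - A + 1 = (C + 1) - A by ring, ← ih (C + 1), Finset.mul_sum]
    refine Finset.sum_congr rfl fun s hs => ?_
    obtain ⟨t, rfl⟩ : ∃ t, p = s + t :=
      ⟨p - s, by have := Finset.mem_range.1 hs; omega⟩
    rw [show s + t + 1 - s = t + 1 by omega, show s + t - s = t by omega,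
      shiftedFactorial_succ_left (C + s), shiftedFactorial_succ A,
      show C + ((s + 1 : ℕ) : ℚ) = C + 1 + s by push_cast; ring,
      show C + s + 1 = C + 1 + s by ring]
    ring

/-- The Pfaff–Saalschütz sum, cleared of denominators. -/
theorem saalschuetz_sum (p : ℕ) (A B C : ℚ) :
    ∑ s ∈ Finset.range (p + 1), (p.choose s : ℚ) *
      (shiftedFactorial A s * shiftedFactorial B s *
        shiftedFactorial (C - A - B) (p - s) * shiftedFactorial (C + s) (p - s)) =
      shiftedFactorial (C - A) p * shiftedFactorial (C - B) p := by
  induction p using Nat.strong_induction_on generalizing A B C with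
  | _ p ih =>
  match p with
  | 0 => simp [shiftedFactorial_zero]
  | 1 =>
    simp [Finset.sum_range_succ, shiftedFactorial_zero, shiftedFactorial_succ]
    ring
  | q + 2 =>
    have h1 := ih (q + 1) (by omega) A B (C + 1)
    -- These two sums share the value `(C + 1 - A)_q (C + 1 - B)_q`; the defect in the recurrence
    -- from `q + 1` to `q + 2` is a multiple of their difference.
    have h2 := ih q (by omega) A B (C + 1)
    have h3 := ih q (by omega) (A + 1) (B + 1) (C + 2)
    rw [show C + 2 - (A + 1) = C + 1 - A by ring, show C + 2 - (B + 1) = C + 1 - B by ring,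
      ← h2] at h3
    rw [shiftedFactorial_succ_left (C - A), shiftedFactorial_succ_left (C - B),
      show C - A + 1 = C + 1 - A by ring, show C - B + 1 = C + 1 - B by ring]
    rw [show (C - A) * shiftedFactorial (C + 1 - A) (q + 1) *
      ((C - B) * shiftedFactorial (C + 1 - B) (q + 1)) = (C - A) * (C - B) *
      (shiftedFactorial (C + 1 - A) (q + 1) * shiftedFactorial (C + 1 - B) (q + 1)) by ring, ← h1,
      Finset.sum_choose_succ_mul (fun s t => shiftedFactorial A s * shiftedFactorial B s *
        shiftedFactorial (C - A - B) t * shiftedFactorial (C + s) t),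
      ← Finset.sum_add_distrib, ← sub_eq_zero, Finset.mul_sum, ← Finset.sum_sub_distrib]
    -- Termwise the defect is `s X_s - (q + 1 - s) Y_s` times `binom(q + 1, s)`; absorbing `s` and
    -- `q + 1 - s` into the binomial coefficient leaves sums of length `q + 1`.
    set X : ℕ → ℚ := fun s => (C + q + 1) * (shiftedFactorial A s * shiftedFactorial B s *
      shiftedFactorial (C - A - B) (q + 1 - s) * shiftedFactorial (C + 1 + s) (q + 1 - s)) with hX
    set Y : ℕ → ℚ := fun s => A * B * (shiftedFactorial A s * shiftedFactorial B s *
      shiftedFactorial (C - A - B + 1) (q - s) * shiftedFactorial (C + 1 + s) (q + 1 - s)) with hY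
    have key : ∀ s ∈ Finset.range (q + 2),
        ((q + 1).choose s : ℚ) * (shiftedFactorial A s * shiftedFactorial B s *
          shiftedFactorial (C - A - B) (q + 1 + 1 - s) * shiftedFactorial (C + s) (q + 1 + 1 - s)) +
        ((q + 1).choose s : ℚ) * (shiftedFactorial A (s + 1) * shiftedFactorial B (s + 1) *
          shiftedFactorial (C - A - B) (q + 1 - s) *
          shiftedFactorial (C + (s + 1 : ℕ)) (q + 1 - s)) -
        (C - A) * (C - B) * (((q + 1).choose s : ℚ) * (shiftedFactorial A s *
          shiftedFactorial B s * shiftedFactorial (C + 1 - A - B) (q + 1 - s) *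
          shiftedFactorial (C + 1 + s) (q + 1 - s))) =
        (s : ℚ) * (q + 1).choose s * X s - ((q : ℚ) + 1 - s) * (q + 1).choose s * Y s := by
      intro s hs
      simp only [hX, hY]
      rw [show C + ((s + 1 : ℕ) : ℚ) = C + 1 + s by push_cast; ring,
        show C + 1 - A - B = C - A - B + 1 by ring, shiftedFactorial_succ A,
        shiftedFactorial_succ B]
      rcases Nat.lt_or_ge q s with h | h
      · obtain rfl : s = q + 1 := by have := Finset.mem_range.1 hs; omega
        rw [show q + 1 + 1 - (q + 1) = 1 by omega, show q + 1 - (q + 1) = 0 by omega]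
        simp only [shiftedFactorial_succ, shiftedFactorial_zero]
        push_cast
        ring
      · obtain ⟨t, rfl⟩ : ∃ t, q = s + t := ⟨q - s, by omega⟩
        rw [show s + t + 1 + 1 - s = t + 1 + 1 by omega, show s + t + 1 - s = t + 1 by omega,
          show s + t - s = t by omega, shiftedFactorial_succ_left (C - A - B) (t + 1),
          shiftedFactorial_succ_left (C + s) (t + 1), shiftedFactorial_succ_left (C - A - B) t,
          shiftedFactorial_succ (C - A - B + 1) t, show C + s + 1 = C + 1 + s by ring]
        push_cast
        ring
    rw [Finset.sum_congr rfl key, Finset.sum_sub_distrib, sub_eq_zero, Finset.sum_range_succ',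
      Finset.sum_range_succ (fun s => ((q : ℚ) + 1 - s) * (q + 1).choose s * Y s)]
    push_cast
    simp only [zero_mul, sub_self, add_zero]
    have hXs : ∀ s ∈ Finset.range (q + 1), ((s : ℚ) + 1) * (q + 1).choose (s + 1) * X (s + 1) =
        ((q + 1) * A * B * (C + q + 1)) * ((q.choose s : ℚ) *
        (shiftedFactorial (A + 1) s * shiftedFactorial (B + 1) s *
        shiftedFactorial (C + 1 - A - (B + 1)) (q - s) *
        shiftedFactorial (C + 2 + s) (q - s))) := by
      intro s hs
      have hc : ((q : ℚ) + 1) * q.choose s = (q + 1).choose (s + 1) * (s + 1) := by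
        exact_mod_cast Nat.add_one_mul_choose_eq q s
      simp only [hX]
      rw [show q + 1 - (s + 1) = q - s by omega, shiftedFactorial_succ_left A,
        shiftedFactorial_succ_left B, show C + 1 - A - (B + 1) = C - A - B by ring,
        show C + 1 + ((s + 1 : ℕ) : ℚ) = C + 2 + s by push_cast; ring,
        mul_comm ((s : ℚ) + 1), ← hc]
      ring
    have hYs : ∀ s ∈ Finset.range (q + 1), ((q : ℚ) + 1 - s) * (q + 1).choose s * Y s =
        ((q + 1) * A * B * (C + q + 1)) * ((q.choose s : ℚ) *
        (shiftedFactorial A s * shiftedFactorial B s *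
        shiftedFactorial (C + 1 - A - B) (q - s) * shiftedFactorial (C + 1 + s) (q - s))) := by
      intro s hs
      obtain ⟨t, rfl⟩ : ∃ t, q = s + t := ⟨q - s, by have := Finset.mem_range.1 hs; omega⟩
      have hc : ((s : ℚ) + t + 1) * (s + t).choose s = (s + t + 1).choose s * (t + 1) := by
        have := Nat.choose_mul_succ_eq (s + t) s
        rw [show s + t + 1 - s = t + 1 by omega] at this
        rw [mul_comm]
        exact_mod_cast this
      simp only [hY]
      rw [show s + t + 1 - s = t + 1 by omega, show s + t - s = t by omega,
        shiftedFactorial_succ (C + 1 + s), show C + 1 - A - B = C - A - B + 1 by ring]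
      push_cast
      rw [show (s : ℚ) + t + 1 - s = t + 1 by ring, mul_comm ((t : ℚ) + 1), ← hc]
      ring
    rw [Finset.sum_congr rfl hXs, Finset.sum_congr rfl hYs, ← Finset.mul_sum, ← Finset.mul_sum, h3]

/-- The signed sum behind the unit Bailey pair; its partial sums have a closed form. -/
theorem sum_choose_mul_wellPoised_eq_zero (q : ℕ) (a : ℚ) :
    ∑ k ∈ Finset.range (q + 2), ((q + 1).choose k : ℚ) * ((-1) ^ k * (a + 2 * k) *
      shiftedFactorial a k * shiftedFactorial (a + 1 + (q + 1 + k)) (q + 1 - k)) = 0 := by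
  have partialSum : ∀ N ≤ q, ∑ k ∈ Finset.range (N + 1), ((q + 1).choose k : ℚ) *
      ((-1) ^ k * (a + 2 * k) * shiftedFactorial a k *
        shiftedFactorial (a + 1 + (q + 1 + k)) (q + 1 - k)) =
      (-1) ^ N * q.choose N * shiftedFactorial a (N + 1) *
        shiftedFactorial (a + 1 + (q + 1 + N)) (q - N) * (a + 2 * q + 2) := by
    intro N
    induction N with
    | zero =>
      intro _
      simp only [zero_add, Finset.range_one, Finset.sum_singleton, Nat.choose_zero_right,
        Nat.sub_zero, shiftedFactorial_succ, shiftedFactorial_zero]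
      push_cast
      ring
    | succ N ih =>
      intro hN
      obtain ⟨t, rfl⟩ : ∃ t, q = N + 1 + t := ⟨q - (N + 1), by omega⟩
      rw [Finset.sum_range_succ, ih (by omega)]
      have h1 : (((N + 1 + t : ℕ) : ℚ) + 1) * (N + 1 + t).choose N =
          (N + 1 + t + 1).choose (N + 1) * (N + 1) := by
        exact_mod_cast Nat.add_one_mul_choose_eq (N + 1 + t) N
      have h2 : (((N + 1 + t : ℕ) : ℚ) + 1) * (N + 1 + t).choose (N + 1) =
          (N + 1 + t + 1).choose (N + 1) * (t + 1) := by
        have := Nat.choose_mul_succ_eq (N + 1 + t) (N + 1)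
        rw [show N + 1 + t + 1 - (N + 1) = t + 1 by omega] at this
        rw [mul_comm]
        exact_mod_cast this
      rw [show N + 1 + t - N = t + 1 by omega, show N + 1 + t + 1 - (N + 1) = t + 1 by omega,
        show N + 1 + t - (N + 1) = t by omega,
        shiftedFactorial_succ_left (a + 1 + (((N + 1 + t : ℕ) : ℚ) + 1 + N)),
        show a + 1 + (((N + 1 + t : ℕ) : ℚ) + 1 + N) + 1 =
          a + 1 + (((N + 1 + t : ℕ) : ℚ) + 1 + (N + 1 : ℕ)) by push_cast; ring,
        shiftedFactorial_succ _ t, shiftedFactorial_succ a (N + 1)]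
      have hq : (((N + 1 + t : ℕ) : ℚ) + 1) ≠ 0 := by positivity
      apply mul_left_cancel₀ hq
      rw [mul_add]
      set Z := shiftedFactorial (a + 1 + (((N + 1 + t : ℕ) : ℚ) + 1 + (N + 1 : ℕ))) t
      set S := shiftedFactorial a (N + 1)
      push_cast at h1 h2 ⊢
      set c := ((N + 1 + t + 1).choose (N + 1) : ℚ)
      linear_combination ((-1) ^ N * S * (a + 1 + (N + 1 + t + 1 + N)) * Z *
        (a + 2 * (N + 1 + t) + 2)) * h1 +
        ((-1) ^ N * S * (a + N + 1) * Z * (a + 2 * (N + 1 + t) + 2)) * h2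
  rw [Finset.sum_range_succ, partialSum q le_rfl]
  simp only [Nat.sub_self, shiftedFactorial_zero, Nat.choose_self]
  push_cast
  ring

/-! ### A Bailey chain -/

/-- The lower triangular operator `(κ f)(i) = ∑_{j ≤ i} κ(j, i) f(j)` on sequences. -/
def lowerTransform (κ : ℕ → ℕ → ℚ) (f : ℕ → ℚ) (i : ℕ) : ℚ :=
  ∑ j ∈ Finset.range (i + 1), κ j i * f j

/-- The kernel of the step of Bailey's lemma in which both free parameters are `1`, relative to
`a`, conjugated by the sequence `i! (a)_i`. -/
noncomputable def baileyKernel (a : ℚ) (j i : ℕ) : ℚ :=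
  j.factorial * i.factorial * shiftedFactorial (a - 1) (i - j) /
    ((i - j).factorial * shiftedFactorial a i * shiftedFactorial a j)

/-- The matrix `1 / ((i - k)! (a + 1)_{i + k})` relating the two members of a Bailey pair relative
to `a`, with its rows multiplied by `i! (a)_i`; it is meant for `k ≤ i`. Its columns are
eigenvectors of `baileyKernel a`. -/
noncomputable def baileyMatrix (a : ℚ) (i k : ℕ) : ℚ :=
  i.factorial * shiftedFactorial a i / ((i - k).factorial * shiftedFactorial (a + 1) (i + k))

/-- The first member of the unit Bailey pair relative to `a`, normalized so that its value at `0`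
is `1`. -/
noncomputable def unitBaileyCoeff (a : ℚ) (k : ℕ) : ℚ :=
  (-1) ^ k * (a + 2 * k) * shiftedFactorial a k / (a * k.factorial)

theorem shiftedFactorial_ne_zero_of_generic {a : ℚ} (ha : ∀ j : ℕ, a + j ≠ 0) (l k : ℕ) :
    shiftedFactorial (a + l) k ≠ 0 :=
  shiftedFactorial_ne_zero fun j _ => by simpa [add_assoc] using ha (l + j)

/-- The unit Bailey pair: the sequence `(1, 0, 0, …)` expanded in the columns of
`baileyMatrix a`. -/
theorem sum_unitBaileyCoeff_mul_baileyMatrix {a : ℚ} (ha : ∀ j : ℕ, a + j ≠ 0) (i : ℕ) :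
    ∑ k ∈ Finset.range (i + 1), unitBaileyCoeff a k * baileyMatrix a i k =
      if i = 0 then 1 else 0 := by
  have h0 : a ≠ 0 := by simpa using ha 0
  match i with
  | 0 => simp [unitBaileyCoeff, baileyMatrix, shiftedFactorial_zero, h0]
  | q + 1 =>
    rw [if_neg (by omega), ← mul_zero (shiftedFactorial a (q + 1) /
      (a * shiftedFactorial (a + 1) (q + 1 + (q + 1)))), ← sum_choose_mul_wellPoised_eq_zero q a,
      Finset.mul_sum]
    refine Finset.sum_congr rfl fun k hk => ?_
    obtain ⟨t, ht⟩ : ∃ t, q + 1 = k + t :=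
      ⟨q + 1 - k, by have := Finset.mem_range.1 hk; omega⟩
    have hq : (q : ℚ) + 1 = k + t := by exact_mod_cast ht
    rw [hq]
    simp only [unitBaileyCoeff, baileyMatrix, ht, Nat.add_sub_cancel_left]
    have h3 := shiftedFactorial_ne_zero_of_generic ha 1 (k + t + k)
    have h4 := shiftedFactorial_ne_zero_of_generic ha (1 + (k + t + k)) t
    rw [show k + t + (k + t) = k + t + k + t by ring, shiftedFactorial_add _ (k + t + k) t,
      Nat.cast_add_choose ℚ]
    push_cast at h3 h4 ⊢
    rw [show a + (1 + ((k : ℚ) + t + k)) = a + 1 + (k + t + k) by ring] at h4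
    field_simp

/-- Column `k` of `baileyMatrix a` is an eigenvector of `baileyKernel a` with eigenvalue
`(k! / (a)_k)^2`. After the shift `j = k + s`, `i = k + p` this is the Saalschütz sum with
`A = B = k + 1` and `C = a + 1 + 2k`. -/
theorem sum_baileyKernel_mul_baileyMatrix {a : ℚ} (ha : ∀ j : ℕ, a + j ≠ 0) (k p : ℕ) :
    ∑ s ∈ Finset.range (p + 1), baileyKernel a (k + s) (k + p) * baileyMatrix a (k + s) k =
      (k.factorial / shiftedFactorial a k) ^ 2 * baileyMatrix a (k + p) k := by
  have hS := saalschuetz_sum p (k + 1) (k + 1) (a + 1 + 2 * k)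
  rw [show a + 1 + 2 * (k : ℚ) - (k + 1) = a + k by ring,
    show a + k - ((k : ℚ) + 1) = a - 1 by ring] at hS
  have hak := shiftedFactorial_ne_zero_of_generic ha 0 k
  have h2k := shiftedFactorial_ne_zero_of_generic ha 1 (2 * k)
  have hC := shiftedFactorial_ne_zero_of_generic ha (1 + 2 * k) p
  push_cast at hak h2k hC
  rw [add_zero] at hak
  rw [← add_assoc] at hC
  have hR : (k.factorial / shiftedFactorial a k : ℚ) ^ 2 * baileyMatrix a (k + p) k =
      (k + p).factorial * k.factorial ^ 2 / (shiftedFactorial a (k + p) *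
        shiftedFactorial (a + 1) (2 * k) * shiftedFactorial (a + 1 + 2 * k) p * p.factorial) *
        (shiftedFactorial (a + k) p * shiftedFactorial (a + k) p) := by
    rw [baileyMatrix, Nat.add_sub_cancel_left, show k + p + k = 2 * k + p by ring,
      shiftedFactorial_add (a + 1), shiftedFactorial_add a k p]
    push_cast
    field_simp
  rw [hR, ← hS, Finset.mul_sum]
  refine Finset.sum_congr rfl fun s hs => ?_
  obtain ⟨t, rfl⟩ : ∃ t, p = s + t := ⟨p - s, by have := Finset.mem_range.1 hs; omega⟩
  have hks := shiftedFactorial_ne_zero_of_generic ha 0 (k + s)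
  have hkst := shiftedFactorial_ne_zero_of_generic ha 0 (k + (s + t))
  push_cast at hks hkst
  rw [add_zero] at hks hkst
  rw [shiftedFactorial_add _ s t] at hC
  have hC2 := right_ne_zero_of_mul hC
  rw [baileyMatrix, baileyKernel, Nat.add_sub_cancel_left, show k + (s + t) - (k + s) = t by omega,
    show s + t - s = t by omega, show k + s + k = 2 * k + s by ring,
    shiftedFactorial_add (a + 1) (2 * k) s, shiftedFactorial_add _ s t,
    Nat.cast_add_choose ℚ, factorial_add_eq_mul_shiftedFactorial k s]
  push_cast
  generalize a + 1 + 2 * (k : ℚ) = C at *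
  field_simp

/-- Bailey's lemma iterated from the unit pair: each step multiplies the coefficient of column `k`
by its eigenvalue. -/
theorem iterate_baileyKernel_unit {a : ℚ} (ha : ∀ j : ℕ, a + j ≠ 0) (m i : ℕ) :
    (lowerTransform (baileyKernel a))^[m] (fun j => if j = 0 then 1 else 0) i =
      ∑ k ∈ Finset.range (i + 1), unitBaileyCoeff a k *
        ((k.factorial / shiftedFactorial a k) ^ (2 * m) * baileyMatrix a i k) := by
  induction m generalizing i with
  | zero => simp [sum_unitBaileyCoeff_mul_baileyMatrix ha]
  | succ m ih =>
    rw [Function.iterate_succ_apply', lowerTransform]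
    simp_rw [ih, Finset.mul_sum]
    rw [Finset.sum_comm' (t' := Finset.range (i + 1)) (s' := fun k => Finset.Ico k (i + 1))
      (by intro x y; simp only [Finset.mem_range, Finset.mem_Ico]; omega)]
    refine Finset.sum_congr rfl fun k hk => ?_
    obtain ⟨p, rfl⟩ : ∃ p, i = k + p := ⟨i - k, by have := Finset.mem_range.1 hk; omega⟩
    rw [Finset.sum_Ico_eq_sum_range, show k + p + 1 - k = p + 1 by omega,
      show 2 * (m + 1) = 2 * m + 2 by ring, pow_add, mul_assoc (_ ^ (2 * m)),
      ← sum_baileyKernel_mul_baileyMatrix ha k p, Finset.mul_sum, Finset.mul_sum]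
    exact Finset.sum_congr rfl fun s _ => by ring

/-- The weighted column sums of `baileyMatrix a`, with `n = k + p` and row index `k + s`: the
Chu–Vandermonde sum with `A = k + 1` and `C = a + 1 + 2k`. The factor `a + n` in the denominator is
the `x` by which the deformed identity is divided. -/
theorem sum_baileyMatrix {a : ℚ} (ha : ∀ j : ℕ, a + j ≠ 0) (k p : ℕ) :
    ∑ s ∈ Finset.range (p + 1), shiftedFactorial (-((k : ℚ) + p)) (k + s) /
        shiftedFactorial a (k + s) * baileyMatrix a (k + s) k =
      shiftedFactorial (-((k : ℚ) + p)) k * k.factorial * a /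
        (shiftedFactorial a k * shiftedFactorial (a + (k + p) + 1) k * (a + (k + p))) := by
  have hV := sum_choose_mul_shiftedFactorial p (k + 1) (a + 1 + 2 * k)
  rw [show a + 1 + 2 * (k : ℚ) - (k + 1) = a + k by ring] at hV
  have hak := shiftedFactorial_ne_zero_of_generic ha 0 k
  have h2k := shiftedFactorial_ne_zero_of_generic ha 1 (2 * k)
  have hC := shiftedFactorial_ne_zero_of_generic ha (1 + 2 * k) p
  have hT := shiftedFactorial_ne_zero_of_generic ha (k + p + 1) k
  have hn := ha (k + p)
  push_cast at hak h2k hC hT hn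
  rw [add_zero] at hak
  rw [← add_assoc] at hC
  rw [show a + ((k : ℚ) + p + 1) = a + (k + p) + 1 by ring] at hT
  have hR : shiftedFactorial (-((k : ℚ) + p)) k * k.factorial * a /
        (shiftedFactorial a k * shiftedFactorial (a + (k + p) + 1) k * (a + (k + p))) =
      shiftedFactorial (-((k : ℚ) + p)) k * k.factorial / (shiftedFactorial (a + 1) (2 * k) *
        shiftedFactorial (a + 1 + 2 * k) p) * shiftedFactorial (a + k) p := by
    have e1 : shiftedFactorial (a + 1) (2 * k) * shiftedFactorial (a + 1 + 2 * k) p * a =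
        shiftedFactorial a k * shiftedFactorial (a + k) p * (a + (k + p)) *
          shiftedFactorial (a + (k + p) + 1) k := by
      have e2 := shiftedFactorial_add (a + 1) (2 * k) p
      push_cast at e2
      have e3 := shiftedFactorial_add a (k + p + 1) k
      push_cast at e3
      rw [← e2, mul_comm, ← shiftedFactorial_succ_left, show 2 * k + p + 1 = k + p + 1 + k by ring,
        e3, shiftedFactorial_succ, shiftedFactorial_add a k p]
      push_cast
      ring_nf
    rw [div_mul_eq_mul_div, div_eq_div_iff (by positivity) (by positivity)]
    linear_combination (shiftedFactorial (-((k : ℚ) + p)) k * k.factorial) * e1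
  rw [hR, ← hV, Finset.mul_sum]
  refine Finset.sum_congr rfl fun s hs => ?_
  obtain ⟨t, rfl⟩ : ∃ t, p = s + t := ⟨p - s, by have := Finset.mem_range.1 hs; omega⟩
  have hks := shiftedFactorial_ne_zero_of_generic ha 0 (k + s)
  have ht' := Nat.factorial_ne_zero t
  push_cast at hks
  rw [add_zero] at hks
  rw [shiftedFactorial_add _ s t] at hC
  have hC2 := right_ne_zero_of_mul hC
  have hneg := shiftedFactorial_neg_mul_factorial s t
  have ht2 : (t.factorial : ℚ) ≠ 0 := by exact_mod_cast ht'
  have hneg' : shiftedFactorial (-((s : ℚ) + t)) s = (-1) ^ s * (s + t).factorial / t.factorial :=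
    (eq_div_iff ht2).2 hneg
  rw [baileyMatrix, Nat.add_sub_cancel_left, show s + t - s = t by omega,
    show k + s + k = 2 * k + s by ring, shiftedFactorial_add (a + 1) (2 * k) s,
    shiftedFactorial_add _ s t, Nat.cast_add_choose ℚ, factorial_add_eq_mul_shiftedFactorial k s,
    shiftedFactorial_add _ k s]
  push_cast
  rw [show -((k : ℚ) + (s + t)) + k = -(s + t) by ring, hneg']
  generalize a + 1 + 2 * (k : ℚ) = C at *
  field_simp

/-- The deformed identity: dividing by `x` and letting `x` tend to `0` gives the theorem. -/
theorem mul_sum_iterate_baileyKernel (n m : ℕ) {x : ℚ} (hx : ∀ j : ℕ, x - n + j ≠ 0) :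
    x * ∑ i ∈ Finset.range (n + 1), shiftedFactorial (-(n : ℚ)) i / shiftedFactorial (x - n) i *
        (lowerTransform (baileyKernel (x - n)))^[m] (fun j => if j = 0 then 1 else 0) i =
      ∑ k ∈ Finset.range (n + 1), (-1) ^ k * (x - n + 2 * k) * shiftedFactorial (-(n : ℚ)) k /
        shiftedFactorial (1 + x) k * (k.factorial / shiftedFactorial (x - n) k) ^ (2 * m) := by
  simp_rw [iterate_baileyKernel_unit hx, Finset.mul_sum]
  rw [Finset.sum_comm' (t' := Finset.range (n + 1)) (s' := fun k => Finset.Ico k (n + 1))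
      (by intro x y; simp only [Finset.mem_range, Finset.mem_Ico]; omega)]
  refine Finset.sum_congr rfl fun k hk => ?_
  obtain ⟨p, rfl⟩ : ∃ p, n = k + p := ⟨n - k, by have := Finset.mem_range.1 hk; omega⟩
  have hS := sum_baileyMatrix hx k p
  have h0 : x - (k + p : ℕ) ≠ 0 := by simpa using hx 0
  have hxk := shiftedFactorial_ne_zero_of_generic hx 0 k
  have hT := shiftedFactorial_ne_zero_of_generic hx (k + p + 1) k
  have hx0 := hx (k + p)
  push_cast at *
  rw [add_zero] at hxk
  rw [show x - ((k : ℚ) + p) + (k + p) = x by ring, add_comm x 1] at hS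
  rw [show x - ((k : ℚ) + p) + (k + p) = x by ring] at hx0
  rw [show x - ((k : ℚ) + p) + (k + p + 1) = 1 + x by ring] at hT
  rw [Finset.sum_Ico_eq_sum_range, show k + p + 1 - k = p + 1 by omega]
  trans x * (unitBaileyCoeff (x - (k + p)) k *
    (k.factorial / shiftedFactorial (x - (k + p)) k) ^ (2 * m)) *
      (shiftedFactorial (-((k : ℚ) + p)) k * k.factorial * (x - (k + p)) /
        (shiftedFactorial (x - (k + p)) k * shiftedFactorial (1 + x) k * x))
  · rw [← hS, Finset.mul_sum]
    exact Finset.sum_congr rfl fun s _ => by ring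
  · rw [unitBaileyCoeff]
    field_simp

/-! ### The limit -/

/-- At the undeformed point `a = -n` the Bailey kernel is `linkFactor n`, up to a factor. -/
theorem baileyKernel_neg_natCast {n j i : ℕ} (hj : j ≤ i) (hi : i ≤ n) :
    baileyKernel (-(n : ℚ)) j i = (1 + n) * linkFactor n j i := by
  obtain ⟨t, rfl⟩ := Nat.exists_eq_add_of_le hj
  obtain ⟨r, rfl⟩ := Nat.exists_eq_add_of_le hi
  have fact (k : ℕ) : (k.factorial : ℚ) ≠ 0 := by exact_mod_cast k.factorial_ne_zero
  have hneg (k l : ℕ) : shiftedFactorial (-((k : ℚ) + l)) k =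
      (-1) ^ k * (k + l).factorial / l.factorial :=
    (eq_div_iff (fact l)).2 (shiftedFactorial_neg_mul_factorial k l)
  have e1 := hneg t (j + r + 1)
  have e2 := hneg (j + t) r
  have e3 := hneg j (t + r)
  have e4 := hneg j t
  have e5 : shiftedFactorial ((r : ℚ) + 1) (j + 1) = (r + (j + 1)).factorial / r.factorial := by
    rw [factorial_add_eq_mul_shiftedFactorial, mul_div_cancel_left₀ _ (fact r)]
  rw [baileyKernel, linkFactor, Nat.add_sub_cancel_left, shiftedFactorial_one]
  push_cast at *
  rw [show -((j : ℚ) + t + r) - 1 = -(t + (j + r + 1)) by ring, e1, e2,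
    show (j : ℚ) + t + r = j + (t + r) by ring, e3, e4,
    show 1 + ((j : ℚ) + (t + r)) - (j + t) = r + 1 by ring, e5,
    show t + (j + r + 1) = j + t + r + 1 by ring, show j + (t + r) = j + t + r by ring,
    show r + (j + 1) = j + r + 1 by ring, Nat.factorial_succ (j + t + r)]
  push_cast
  have hsign : ((-1 : ℚ) ^ j) ^ 2 = 1 := by rw [← pow_mul, mul_comm, pow_mul]; simp
  rw [pow_add]
  field_simp
  rw [hsign]
  ring

theorem shiftedFactorial_neg_natCast_ne_zero {n k : ℕ} (h : k ≤ n) :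
    shiftedFactorial (-(n : ℚ)) k ≠ 0 := by
  refine shiftedFactorial_ne_zero fun j hj h0 => ?_
  have : (j : ℚ) = n := by linarith
  have : j = n := by exact_mod_cast this
  omega

theorem iterate_baileyKernel_neg_natCast (n m : ℕ) (f : ℕ → ℚ) {i : ℕ} (hi : i ≤ n) :
    (lowerTransform (baileyKernel (-(n : ℚ))))^[m] f i =
      (1 + (n : ℚ)) ^ m * (lowerTransform (linkFactor n))^[m] f i := by
  induction m generalizing i with
  | zero => simp
  | succ m ih =>
    rw [Function.iterate_succ_apply', Function.iterate_succ_apply', lowerTransform, lowerTransform,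
      Finset.mul_sum]
    refine Finset.sum_congr rfl fun j hj => ?_
    have hj : j ≤ i := by have := Finset.mem_range.1 hj; omega
    rw [ih (hj.trans hi), baileyKernel_neg_natCast hj hi]
    ring

theorem continuous_shiftedFactorial (k : ℕ) : Continuous fun x => shiftedFactorial x k :=
  (ascPochhammer ℚ k).continuous

theorem continuousAt_iterate_baileyKernel (n m : ℕ) (f : ℕ → ℚ) {i : ℕ} (hi : i ≤ n) :
    ContinuousAt (fun x : ℚ => (lowerTransform (baileyKernel (x - n)))^[m] f i) 0 := by
  induction m generalizing i with
  | zero => exact continuousAt_const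
  | succ m ih =>
    simp_rw [Function.iterate_succ_apply', lowerTransform]
    refine tendsto_finsetSum _ fun j hj => ?_
    have hj : j ≤ i := by have := Finset.mem_range.1 hj; omega
    refine ContinuousAt.mul ?_ (ih (hj.trans hi))
    have h (c : ℚ) (k : ℕ) : ContinuousAt (fun x => shiftedFactorial (x - c) k) 0 :=
      ((continuous_shiftedFactorial k).comp (continuous_id.sub continuous_const)).continuousAt
    simp_rw [baileyKernel, sub_sub]
    refine (continuousAt_const.mul (h _ _)).div
      ((continuousAt_const.mul (h _ _)).mul (h _ _)) ?_
    rw [zero_sub]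
    exact mul_ne_zero (mul_ne_zero (by exact_mod_cast Nat.factorial_ne_zero _)
      (shiftedFactorial_neg_natCast_ne_zero hi))
      (shiftedFactorial_neg_natCast_ne_zero (hj.trans hi))

theorem hasDerivAt_shiftedFactorial {c : ℚ} {k : ℕ} (hc : ∀ j < k, c + (j : ℚ) ≠ 0) :
    HasDerivAt (fun x => shiftedFactorial (c + x) k)
      (shiftedFactorial c k * ∑ j ∈ Finset.range k, 1 / (c + j)) 0 := by
  induction k with
  | zero => simpa [shiftedFactorial_zero] using hasDerivAt_const (0 : ℚ) (1 : ℚ)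
  | succ k ih =>
    simp_rw [shiftedFactorial_succ]
    have h := (ih fun j hj => hc j (by omega)).mul
      (((hasDerivAt_id (0 : ℚ)).const_add c).add_const (k : ℚ))
    refine h.congr_deriv ?_
    rw [Finset.sum_range_succ]
    have := hc k (by omega)
    simp only [id, add_zero]
    field_simp

theorem sum_one_div_one_add (k : ℕ) :
    ∑ j ∈ Finset.range k, 1 / (1 + (j : ℚ)) = harmonic k := by
  simp [harmonic, add_comm]

theorem sum_one_div_neg_add (k r : ℕ) :
    ∑ j ∈ Finset.range k, 1 / (-((k + r : ℕ) : ℚ) + j) = harmonic r - harmonic (k + r) := by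
  induction k generalizing r with
  | zero => simp
  | succ k ih =>
    have h := ih (r + 1)
    rw [show k + (r + 1) = k + 1 + r by ring] at h
    rw [Finset.sum_range_succ, h, harmonic_succ]
    have h1 : ((r : ℚ) + 1) ≠ 0 := by positivity
    have h2 : -((k + 1 + r : ℕ) : ℚ) + k = -(r + 1) := by push_cast; ring
    rw [h2]
    push_cast
    field_simp
    ring

/-- The terms of the deformed sum: their derivatives at `x = 0`. -/
theorem hasDerivAt_deformedTerm (m k r : ℕ) :
    HasDerivAt (fun x : ℚ => (-1) ^ k * (x - (k + r : ℕ) + 2 * k) *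
        shiftedFactorial (-((k + r : ℕ) : ℚ)) k / shiftedFactorial (1 + x) k *
          (k.factorial / shiftedFactorial (x - (k + r : ℕ)) k) ^ (2 * m))
      (((k + r).choose k : ℚ) ^ (1 - 2 * (m : ℤ)) * (1 + (2 * k - (k + r : ℕ)) *
        (-harmonic k - 2 * m * (harmonic r - harmonic (k + r))))) 0 := by
  set n := k + r with hn
  have hk0 : (k.factorial : ℚ) ≠ 0 := by exact_mod_cast k.factorial_ne_zero
  have hr0 : (r.factorial : ℚ) ≠ 0 := by exact_mod_cast r.factorial_ne_zero
  have hnk : shiftedFactorial (-(n : ℚ)) k ≠ 0 := shiftedFactorial_neg_natCast_ne_zero (by omega)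
  have h1 : HasDerivAt (fun x : ℚ => shiftedFactorial (1 + x) k) (k.factorial * harmonic k) 0 := by
    rw [← sum_one_div_one_add, ← shiftedFactorial_one]
    exact hasDerivAt_shiftedFactorial fun j _ => by positivity
  have h2 : HasDerivAt (fun x : ℚ => shiftedFactorial (x - n) k)
      (shiftedFactorial (-(n : ℚ)) k * (harmonic r - harmonic n)) 0 := by
    rw [hn, ← sum_one_div_neg_add, ← hn]
    simp_rw [sub_eq_neg_add]
    refine hasDerivAt_shiftedFactorial fun j hj h0 => ?_
    have : (j : ℚ) = n := by linarith
    have : j = n := by exact_mod_cast this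
    omega
  have hlin : HasDerivAt (fun x : ℚ => (-1) ^ k * (x - n + 2 * k) *
      shiftedFactorial (-(n : ℚ)) k) ((-1) ^ k * 1 * shiftedFactorial (-(n : ℚ)) k) 0 :=
    ((((hasDerivAt_id (0 : ℚ)).sub_const _).add_const _).const_mul _).mul_const _
  have e1 : shiftedFactorial (1 + (0 : ℚ)) k = k.factorial := by
    rw [add_zero, shiftedFactorial_one]
  have h := (hlin.div h1 (by rw [e1]; exact hk0)).mul
    (((hasDerivAt_const (0 : ℚ) (k.factorial : ℚ)).div h2 (by rwa [zero_sub])).pow (2 * m))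
  have hc : ((n.choose k : ℕ) : ℚ) = (-1) ^ k * shiftedFactorial (-(n : ℚ)) k / k.factorial := by
    have h := shiftedFactorial_neg_mul_factorial k r
    rw [hn, Nat.cast_add_choose ℚ, div_eq_div_iff (mul_ne_zero hk0 hr0) hk0]
    push_cast
    have hsign : (-1 : ℚ) ^ k * (-1) ^ k = 1 := by rw [← mul_pow]; simp
    linear_combination -((-1) ^ k * (k.factorial : ℚ)) * h -
      ((k + r).factorial * k.factorial : ℚ) * hsign
  have hpow : ((n.choose k : ℕ) : ℚ) ^ (1 - 2 * (m : ℤ)) = n.choose k *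
      (k.factorial / shiftedFactorial (-(n : ℚ)) k) ^ (2 * m) := by
    have hc0 : ((n.choose k : ℕ) : ℚ) ≠ 0 := by
      exact_mod_cast (Nat.choose_pos (by omega : k ≤ n)).ne'
    rw [zpow_sub₀ hc0, zpow_one, div_eq_mul_inv]
    congr 1
    have : (2 * (m : ℤ)) = ((2 * m : ℕ) : ℤ) := by push_cast; rfl
    rw [this, zpow_natCast, ← inv_pow, pow_mul, pow_mul]
    congr 1
    rw [hc]
    have hsign : ((-1 : ℚ) ^ k) ^ 2 = 1 := by rw [← pow_mul, mul_comm, pow_mul]; simp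
    field_simp
    rw [hsign]
  refine h.congr_deriv ?_
  rw [hpow, hc]
  simp only [e1, Pi.pow_apply, Pi.div_apply, zero_sub]
  -- The exponent `2 * m - 1` from the power rule is truncated at `m = 0`.
  match m with
  | 0 =>
    simp
    field_simp
    ring
  | m + 1 =>
    rw [show 2 * (m + 1) - 1 = 2 * m + 1 by omega, show 2 * (m + 1) = 2 * m + 1 + 1 by ring,
      pow_succ _ (2 * m + 1)]
    push_cast
    field_simp
    ring

/-- The summand `binom(n,k)^u (n - 2k)` changes sign under `k ↦ n - k`. -/
theorem sum_choose_zpow_mul_reflect (n : ℕ) (u : ℤ) (g : ℕ → ℚ) :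
    ∑ k ∈ Finset.range (n + 1), (n.choose k : ℚ) ^ u * (n - 2 * k) * g (n - k) =
      -∑ k ∈ Finset.range (n + 1), (n.choose k : ℚ) ^ u * (n - 2 * k) * g k := by
  rw [← Finset.sum_range_reflect, ← Finset.sum_neg_distrib]
  refine Finset.sum_congr rfl fun k hk => ?_
  have hk : k ≤ n := by have := Finset.mem_range.1 hk; omega
  rw [show n + 1 - 1 - k = n - k by omega, Nat.choose_symm hk, Nat.sub_sub_self hk,
    Nat.cast_sub hk]
  ring

theorem sum_choose_zpow_mul_sub (n : ℕ) (u : ℤ) :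
    ∑ k ∈ Finset.range (n + 1), (n.choose k : ℚ) ^ u * (n - 2 * k) = 0 := by
  have := sum_choose_zpow_mul_reflect n u fun _ => 1
  simp only [mul_one] at this
  linarith

/-- The derivative at `x = 0` of the deformed sum is `T_n^{(1-2m)}`. -/
theorem hasDerivAt_deformedSum (n m : ℕ) :
    HasDerivAt (fun x : ℚ => ∑ k ∈ Finset.range (n + 1), (-1) ^ k * (x - n + 2 * k) *
        shiftedFactorial (-(n : ℚ)) k / shiftedFactorial (1 + x) k *
          (k.factorial / shiftedFactorial (x - n) k) ^ (2 * m))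
      (pauleSchneiderT n (1 - 2 * (m : ℤ))) 0 := by
  have h : HasDerivAt (fun x : ℚ => ∑ k ∈ Finset.range (n + 1), (-1) ^ k * (x - n + 2 * k) *
        shiftedFactorial (-(n : ℚ)) k / shiftedFactorial (1 + x) k *
          (k.factorial / shiftedFactorial (x - n) k) ^ (2 * m))
      (∑ k ∈ Finset.range (n + 1), (n.choose k : ℚ) ^ (1 - 2 * (m : ℤ)) * (1 + (2 * k - n) *
        (-harmonic k - 2 * m * (harmonic (n - k) - harmonic n)))) 0 := by
    refine HasDerivAt.fun_sum fun k hk => ?_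
    obtain ⟨r, rfl⟩ : ∃ r, n = k + r := ⟨n - k, by have := Finset.mem_range.1 hk; omega⟩
    rw [Nat.add_sub_cancel_left]
    exact hasDerivAt_deformedTerm m k r
  refine h.congr_deriv ?_
  have h1 := sum_choose_zpow_mul_reflect n (1 - 2 * (m : ℤ)) harmonic
  have h2 := sum_choose_zpow_mul_sub n (1 - 2 * (m : ℤ))
  have h3 : ∑ k ∈ Finset.range (n + 1), (n.choose k : ℚ) ^ (1 - 2 * (m : ℤ)) * (1 + (2 * k - n) *
        (-harmonic k - 2 * m * (harmonic (n - k) - harmonic n))) =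
      pauleSchneiderT n (1 - 2 * (m : ℤ)) +
      2 * m * (∑ k ∈ Finset.range (n + 1),
        (n.choose k : ℚ) ^ (1 - 2 * (m : ℤ)) * (n - 2 * k) * harmonic k) +
      2 * m * (∑ k ∈ Finset.range (n + 1),
        (n.choose k : ℚ) ^ (1 - 2 * (m : ℤ)) * (n - 2 * k) * harmonic (n - k)) -
      2 * m * harmonic n * (∑ k ∈ Finset.range (n + 1),
        (n.choose k : ℚ) ^ (1 - 2 * (m : ℤ)) * (n - 2 * k)) := by
    rw [pauleSchneiderT, Finset.mul_sum, Finset.mul_sum, Finset.mul_sum, ← Finset.sum_add_distrib,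
      ← Finset.sum_add_distrib, ← Finset.sum_sub_distrib]
    refine Finset.sum_congr rfl fun k _ => ?_
    push_cast
    ring
  rw [h3, h1, h2]
  ring

theorem pauleSchneiderT_eq_sum_iterate (n m : ℕ) :
    pauleSchneiderT n (1 - 2 * (m : ℤ)) = (1 + (n : ℚ)) ^ m * ∑ i ∈ Finset.range (n + 1),
      (lowerTransform (linkFactor n))^[m] (fun j => if j = 0 then 1 else 0) i := by
  have hΦ := hasDerivAt_deformedSum n m
  set Φ : ℚ → ℚ := fun x => ∑ k ∈ Finset.range (n + 1), (-1) ^ k * (x - n + 2 * k) *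
        shiftedFactorial (-(n : ℚ)) k / shiftedFactorial (1 + x) k *
          (k.factorial / shiftedFactorial (x - n) k) ^ (2 * m) with hΦdef
  set R : ℚ → ℚ := fun x => ∑ i ∈ Finset.range (n + 1),
    shiftedFactorial (-(n : ℚ)) i / shiftedFactorial (x - n) i *
        (lowerTransform (baileyKernel (x - n)))^[m] (fun j => if j = 0 then 1 else 0) i with hR
  have hRc : ContinuousAt R 0 := by
    refine tendsto_finsetSum _ fun i hi => ?_
    have hi : i ≤ n := by have := Finset.mem_range.1 hi; omega
    refine ContinuousAt.mul (continuousAt_const.div ((continuous_shiftedFactorial i).comp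
      (continuous_id.sub continuous_const)).continuousAt ?_)
      (continuousAt_iterate_baileyKernel n m _ hi)
    simpa using shiftedFactorial_neg_natCast_ne_zero hi
  have hev : ∀ᶠ x in nhdsWithin (0 : ℚ) {0}ᶜ, x * R x = Φ x := by
    have h1 : ∀ᶠ x : ℚ in nhdsWithin (0 : ℚ) {0}ᶜ, |x| < 1 :=
      ((continuous_abs.tendsto' (0 : ℚ) 0 abs_zero).eventually_lt_const one_pos).filter_mono
        nhdsWithin_le_nhds
    filter_upwards [h1, self_mem_nhdsWithin] with x hx hx0
    refine mul_sum_iterate_baileyKernel n m fun j h0 => hx0 ?_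
    -- A vanishing factor would make `x` an integer, and `0` is the only one with `|x| < 1`.
    have hxz : x = (((n : ℤ) - j : ℤ) : ℚ) := by push_cast; linarith
    rw [hxz] at hx
    have : |(n : ℤ) - j| < 1 := by exact_mod_cast hx
    rw [Int.abs_lt_one_iff] at this
    rw [hxz, this]
    simp
  have hΦ0 : Φ 0 = 0 := by
    have t1 : Filter.Tendsto Φ (nhdsWithin 0 {0}ᶜ) (nhds (Φ 0)) :=
      hΦ.continuousAt.tendsto.mono_left nhdsWithin_le_nhds
    have t2 : Filter.Tendsto (fun x => x * R x) (nhdsWithin 0 {0}ᶜ) (nhds (0 * R 0)) :=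
      (continuousAt_id.mul hRc).tendsto.mono_left nhdsWithin_le_nhds
    rw [zero_mul] at t2
    exact tendsto_nhds_unique t1 (t2.congr' hev)
  have hslope : Filter.Tendsto R (nhdsWithin 0 {0}ᶜ)
      (nhds (pauleSchneiderT n (1 - 2 * (m : ℤ)))) := by
    refine (hasDerivAt_iff_tendsto_slope_zero.1 hΦ).congr' ?_
    filter_upwards [hev, self_mem_nhdsWithin] with x hx hx0
    have hx0 : x ≠ 0 := hx0
    rw [zero_add, hΦ0, sub_zero, ← hx, smul_eq_mul, inv_mul_cancel_left₀ hx0]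
  rw [tendsto_nhds_unique hslope (hRc.tendsto.mono_left nhdsWithin_le_nhds), hR, Finset.mul_sum]
  refine Finset.sum_congr rfl fun i hi => ?_
  have hi : i ≤ n := by have := Finset.mem_range.1 hi; omega
  rw [zero_sub, div_self (shiftedFactorial_neg_natCast_ne_zero hi), one_mul,
    iterate_baileyKernel_neg_natCast n m _ hi]

/-! ### Sums over monotone tuples -/

theorem linkFactor_eq_zero_of_lt {n j i : ℕ} (h : i < j) : linkFactor n j i = 0 := by
  rw [linkFactor, shiftedFactorial_neg_natCast_eq_zero h]
  simp

/-- The initial factor `1 / (1 + n - i)` is itself one application of the kernel. -/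
theorem lowerTransform_linkFactor_unit (n : ℕ) :
    lowerTransform (linkFactor n) (fun j => if j = 0 then 1 else 0) =
      fun i : ℕ => 1 / (1 + (n : ℚ) - i) := by
  funext i
  simp [lowerTransform, linkFactor, shiftedFactorial_zero, shiftedFactorial_succ]

/-- Unrolling the iterates of `lowerTransform` into a sum over all tuples. -/
theorem sum_tuple_mul_prod_linkFactor (n q : ℕ) (f : ℕ → ℚ) :
    ∑ i : Fin (q + 1) → Fin (n + 1),
        f (i 0) * ∏ r : Fin q, linkFactor n (i r.castSucc) (i r.succ) =
      ∑ i ∈ Finset.range (n + 1), (lowerTransform (linkFactor n))^[q] f i := by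
  induction q generalizing f with
  | zero =>
    rw [← Fin.sum_univ_eq_sum_range, ← (Equiv.funUnique (Fin 1) (Fin (n + 1))).sum_comp]
    simp
  | succ q ih =>
    rw [Function.iterate_succ_apply, ← ih, ← (Fin.consEquiv fun _ => Fin (n + 1)).sum_comp,
      Fintype.sum_prod_type, Finset.sum_comm]
    refine Finset.sum_congr rfl fun i _ => ?_
    have hL : lowerTransform (linkFactor n) f (i 0) =
        ∑ j : Fin (n + 1), linkFactor n j (i 0) * f j := by
      rw [Fin.sum_univ_eq_sum_range (fun j => linkFactor n j (i 0) * f j), lowerTransform]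
      refine Finset.sum_subset (Finset.range_subset_range.2 (by omega)) fun j _ hj => ?_
      rw [linkFactor_eq_zero_of_lt (by simpa using hj), zero_mul]
    rw [hL, Finset.sum_mul]
    refine Finset.sum_congr rfl fun j _ => ?_
    rw [Fin.prod_univ_succ]
    simp only [Fin.consEquiv_apply, Fin.castSucc_zero, Fin.cons_zero, Fin.cons_succ,
      ← Fin.succ_castSucc]
    ring

/-- Since `linkFactor n j i` vanishes for `i < j`, only the monotone tuples contribute. -/
theorem sum_monotone_mul_prod_linkFactor (n q : ℕ) (f : ℕ → ℚ) :
    ∑ i : Fin (q + 1) → Fin (n + 1) with Monotone i,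
        f (i 0) * ∏ r : Fin q, linkFactor n (i r.castSucc) (i r.succ) =
      ∑ i ∈ Finset.range (n + 1), (lowerTransform (linkFactor n))^[q] f i := by
  rw [← sum_tuple_mul_prod_linkFactor]
  refine Finset.sum_filter_of_ne fun i _ hi => Fin.monotone_iff_le_succ.2 fun r => ?_
  by_contra h
  refine hi (mul_eq_zero_of_right _ (Finset.prod_eq_zero (Finset.mem_univ r) ?_))
  exact linkFactor_eq_zero_of_lt (by simpa using h)

theorem pauleSchneiderT_eq_sum_iterate_succ (n q : ℕ) :
    pauleSchneiderT n (1 - 2 * ((q + 1 : ℕ) : ℤ)) = (1 + (n : ℚ)) ^ (q + 1) *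
      ∑ i ∈ Finset.range (n + 1),
        (lowerTransform (linkFactor n))^[q] (fun i : ℕ => 1 / (1 + (n : ℚ) - i)) i := by
  rw [pauleSchneiderT_eq_sum_iterate, Function.iterate_succ, Function.comp_apply,
    lowerTransform_linkFactor_unit]

theorem mainTheorem4 :
    (∀ (n m : ℕ) (hm : 1 ≤ m),
      pauleSchneiderT n (1 - 2 * (m : ℤ)) =
        (1 + (n : ℚ)) ^ m *
          ∑ i : Fin m → Fin (n + 1) with Monotone i,
            1 / (1 + (n : ℚ) - ((i ⟨0, by omega⟩ : ℕ) : ℚ)) *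
              ∏ r : Fin (m - 1),
                linkFactor n (i ⟨(r : ℕ), by omega⟩) (i ⟨(r : ℕ) + 1, by omega⟩)) ∧
    (∀ n : ℕ,
      pauleSchneiderT n (-3) =
        (1 + (n : ℚ)) ^ 2 *
          ∑ i ∈ Finset.range (n + 1), ∑ j ∈ Finset.range (i + 1),
            linkFactor n j i * (1 / (1 + (n : ℚ) - (j : ℚ)))) ∧
    (∀ n : ℕ,
      pauleSchneiderT n (-5) =
        (1 + (n : ℚ)) ^ 3 *
          ∑ i ∈ Finset.range (n + 1), ∑ j ∈ Finset.range (i + 1),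
            linkFactor n j i *
              ∑ t ∈ Finset.range (j + 1),
                linkFactor n t j * (1 / (1 + (n : ℚ) - (t : ℚ)))) := by
  refine ⟨fun n m hm => ?_, fun n => ?_, fun n => ?_⟩
  · obtain ⟨q, rfl⟩ : ∃ q, m = q + 1 := ⟨m - 1, by omega⟩
    rw [pauleSchneiderT_eq_sum_iterate_succ, ← sum_monotone_mul_prod_linkFactor]
    rfl
  · exact pauleSchneiderT_eq_sum_iterate_succ n 1
  · exact pauleSchneiderT_eq_sum_iterate_succ n 2
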